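/- **Theorem (betweenness is neither score nor rank monotone).** Graphs are finite, simple and undirected. The *betweenness* of a vertex $x$ of $G$ is $c_G(x)=\sum_{\{y,z\}}\sigma_{yz}(x)/\sigma_{yz}$, where $\{y,z\}$ ranges over the unordered pairs of distinct vertices different from $x$, $\sigma_{yz}$ is the number of shortest paths between $y$ and $z$, and $\sigma_{yz}(x)$ is the number of those that pass through $x$ (pairs with $\sigma_{yz}=0$ contribute $0$). A centrality $c$ is *score monotone on* $G$ if for every pair of distinct non-adjacent vertices $x,y$, writing $G'$ for $G$ with the new edge $x\,\text{—}\,y$, we have $c_G(x)<c_{G'}(x)$ and $c_G(y)<c_{G'}(y)$. It is *rank monotone on* $G$ if for all such $x,y$, every vertex $z\ne x,y$ and each endpoint $w\in\{x,y\}$: $c_G(z)<c_G(w)$ implies $c_{G'}(z)<c_{G'}(w)$, and $c_G(z)\le c_G(w)$ implies $c_{G'}(z)\le c_{G'}(w)$. If one of these implications fails with $w=x$, we have a violation of rank monotonicity at the endpoint $x$; it is a *top violation* if $c_G(x)>c_G(y)$, and a *bottom violation* otherwise. For integers $k,h,j\ge 0$ let $G=G_{k,h,j}$ be the graph consisting of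 the hexagon $1\,\text{—}\,2\,\text{—}\,d\,\text{—}\,c\,\text{—}\,b\,\text{—}\,a\,\text{—}\,1$, a vertex $0$ joined to $a$, $k$ leaves attached to $0$, $h$ leaves attached to $1$, and $j$ pairwise non-adjacent vertices (labeled with $4$), each of which is adjacent exactly to $c$ and $d$. Let $G'$ be $G$ with the new edge $0\,\text{—}\,1$, and write $\operatorname{pre}$ and $\operatorname{post}$ for the betweenness in $G$ and in $G'$. 1. For all $k,h,j\ge 0$ the graph $G$ is connected, $0$ and $1$ are not adjacent in $G$, and $\operatorname{post}(0)=\operatorname{pre}(0)$; hence betweenness is not score monotone on $G$. 2. (Top violation.) If $k=h+2$, $j=4h$ and $h\ge 12$, then $\operatorname{pre}(0)>\operatorname{pre}(1)$, $\operatorname{pre}(0)>\operatorname{pre}(2)$ and $\operatorname{post}(0)<\operatorname{post}(2)$; hence adding $0\,\text{—}\,1$ is a top violation of rank monotonicity at the endpoint $0$, and betweenness is not rank monotone on $G$. 3. (Bottom violation.) If $h=k$, $j=\lfloor (k^2-4k-15)/2\rfloor$ and $k\ge 13$, then $\operatorname{pre}(0)<\operatorname{pre}(1)$, $\operatorname{pre}(0)>\operatorname{pre}(2)$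 and $\operatorname{post}(0)<\operatorname{post}(2)$; hence adding $0\,\text{—}\,1$ is a bottom violation of rank monotonicity at the endpoint $0$, and betweenness is not rank monotone on $G$. In particular, betweenness is neither score monotone nor rank monotone on undirected graphs. -/

import Mathlib

namespace Centrality

/-- The graph obtained from `G` by adding the edge between `x` and `y`. -/
def addEdge {V : Type*} (G : SimpleGraph V) (x y : V) : SimpleGraph V :=
  G ⊔ SimpleGraph.edge x y

/-- The number of shortest paths of `G` from `y` to `z`
(it is `0` if `z` cannot be reached from `y`). -/
noncomputable def numShortest {V : Type*} (G : SimpleGraph V) (y z : V) : ℕ :=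
  Set.ncard {p : G.Walk y z | p.length = G.dist y z}

/-- The number of shortest paths of `G` from `y` to `z` that pass through `x`. -/
noncomputable def numShortestThrough {V : Type*} (G : SimpleGraph V) (y z x : V) : ℕ :=
  Set.ncard {p : G.Walk y z | p.length = G.dist y z ∧ x ∈ p.support}

open Classical in
/-- The betweenness of `x`: the sum, over the unordered pairs `{y, z}` of distinct vertices
different from `x`, of the fraction of the shortest paths between `y` and `z` that pass through
`x`; a pair that is not connected contributes `0 / 0 = 0`. The sum below runs over ordered pairs,
whence the division by two. -/
noncomputable def betweenness {V : Type*} [Fintype V] (G : SimpleGraph V) (x : V) : ℝ :=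
  (∑ y : V, ∑ z : V,
    if y ≠ x ∧ z ≠ x ∧ y ≠ z then
      (numShortestThrough G y z x : ℝ) / (numShortest G y z : ℝ)
    else 0) / 2

/-- Score monotonicity on `G` of a centrality `c`. -/
def ScoreMonotoneOn {V : Type*} (c : SimpleGraph V → V → ℝ) (G : SimpleGraph V) : Prop :=
  ∀ x y : V, x ≠ y → ¬ G.Adj x y →
    c G x < c (addEdge G x y) x ∧ c G y < c (addEdge G x y) y

/-- Rank monotonicity on `G` of a centrality `c`. -/
def RankMonotoneOn {V : Type*} (c : SimpleGraph V → V → ℝ) (G : SimpleGraph V) : Prop :=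
  ∀ x y : V, x ≠ y → ¬ G.Adj x y → ∀ z : V, z ≠ x → z ≠ y →
    ((c G z < c G x → c (addEdge G x y) z < c (addEdge G x y) x) ∧
      (c G z < c G y → c (addEdge G x y) z < c (addEdge G x y) y)) ∧
    ((c G z ≤ c G x → c (addEdge G x y) z ≤ c (addEdge G x y) x) ∧
      (c G z ≤ c G y → c (addEdge G x y) z ≤ c (addEdge G x y) y))

/-- Score monotonicity on all finite undirected graphs. -/
def ScoreMonotone (c : ∀ (V : Type) [Fintype V], SimpleGraph V → V → ℝ) : Prop :=
  ∀ (V : Type) [Fintype V] (G : SimpleGraph V), ScoreMonotoneOn (c V) G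

/-- Rank monotonicity on all finite undirected graphs. -/
def RankMonotone (c : ∀ (V : Type) [Fintype V], SimpleGraph V → V → ℝ) : Prop :=
  ∀ (V : Type) [Fintype V] (G : SimpleGraph V), RankMonotoneOn (c V) G

/-- Adding the edge between the non-adjacent vertices `x` and `y` to `G` violates rank
monotonicity at the endpoint `x`, with respect to some third vertex `z`. -/
def RankViolationAt {V : Type*} (c : SimpleGraph V → V → ℝ) (G : SimpleGraph V) (x y : V) :
    Prop :=
  x ≠ y ∧ ¬ G.Adj x y ∧ ∃ z : V, z ≠ x ∧ z ≠ y ∧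
    ((c G z < c G x ∧ ¬ c (addEdge G x y) z < c (addEdge G x y) x) ∨
      (c G z ≤ c G x ∧ ¬ c (addEdge G x y) z ≤ c (addEdge G x y) x))

/-- A top violation of rank monotonicity: the losing endpoint `x` of the new edge is more
important than the other endpoint `y`. -/
def TopRankViolation {V : Type*} (c : SimpleGraph V → V → ℝ) (G : SimpleGraph V) (x y : V) :
    Prop :=
  RankViolationAt c G x y ∧ c G y < c G x

/-- A bottom violation of rank monotonicity: the losing endpoint `x` of the new edge is not more
important than the other endpoint `y`. -/
def BottomRankViolation {V : Type*} (c : SimpleGraph V → V → ℝ) (G : SimpleGraph V) (x y : V) :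
    Prop :=
  RankViolationAt c G x y ∧ ¬ c G y < c G x

/-- The vertices of the parametric graph: seven special vertices, `k` leaves of the star around
vertex `0`, `h` leaves of the star around vertex `1`, and the `j` vertices labeled with `4`. -/
abbrev Vtx (k h j : ℕ) : Type := Fin 7 ⊕ (Fin k ⊕ (Fin h ⊕ Fin j))

/-- The special vertices `0`, …, `6` of the parametric graph. The special vertices number `3`,
`4`, `5`, `6` are also called `a`, `b`, `c`, `d`. -/
abbrev special {k h j : ℕ} (i : Fin 7) : Vtx k h j := Sum.inl i

/-- One orientation of each edge of the parametric graph. The edges between special vertices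
are those of the hexagon `1 — 2 — d — c — b — a — 1` and the edge `0 — a`. Each of the `j`
vertices labeled with `4` is adjacent exactly to `c` and to `d`. -/
def arc (k h j : ℕ) : Vtx k h j → Vtx k h j → Prop
  | Sum.inl x, Sum.inl y =>
      (x = 0 ∧ y = 3) ∨ (x = 1 ∧ y = 3) ∨ (x = 1 ∧ y = 2) ∨ (x = 2 ∧ y = 6) ∨
      (x = 3 ∧ y = 4) ∨ (x = 4 ∧ y = 5) ∨ (x = 5 ∧ y = 6)
  | Sum.inl x, Sum.inr (Sum.inl _) => x = 0
  | Sum.inl x, Sum.inr (Sum.inr (Sum.inl _)) => x = 1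
  | Sum.inl x, Sum.inr (Sum.inr (Sum.inr _)) => x = 5 ∨ x = 6
  | Sum.inr _, _ => False

/-- The parametric graph (before the edge `0 — 1` is added). -/
def pre (k h j : ℕ) : SimpleGraph (Vtx k h j) := SimpleGraph.fromRel (arc k h j)

/-- The parametric graph after the edge `0 — 1` has been added. -/
def post (k h j : ℕ) : SimpleGraph (Vtx k h j) :=
  addEdge (pre k h j) (special 0) (special 1)

end Centrality

/-! The leaves at `0`, the leaves at `1` and the vertices labeled `4` are three classes of twins.
Distances and numbers of shortest paths between distinct vertices thus depend only on ten vertex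
types, not on `k`, `h`, `j`. Local recurrences characterize both quantities, so finite checks
certify the tables (`IsPathTable`), and the betweenness of a special vertex becomes an explicit
quadratic polynomial (`IsPathTable.betweenness_eq`).

In `G` and in `G'`, the only neighbours of `0` other than its leaves are `a` and, in `G'`, also `1`;
since `a` and `1` are adjacent, no shortest path goes `a — 0 — 1`. Hence `0` lies inside a shortest
path only when an endpoint is one of its leaves, and its score does not change. Vertex `2` gains
`(k+1)(j+1)/2`: it now carries half of the shortest paths from `0` and its leaves to the vertices
`4`, and all rather than half of those to `d`. For the chosen parameters this gain lifts `2` above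
`0`. -/

namespace SimpleGraph

/-! ### Distances from a local recurrence -/

variable {V : Type*} {G : SimpleGraph V}

theorem Walk.append_inj_of_length_eq {u v w : V} {p p' : G.Walk u v} {q q' : G.Walk v w}
    (hl : p.length = p'.length) (h : p.append q = p'.append q') : p = p' ∧ q = q' := by
  induction p with
  | nil =>
    cases p' with
    | nil => simpa using h
    | cons _ _ => simp at hl
  | cons hadj r ih =>
    cases p' with
    | nil => simp at hl
    | cons hadj' r' =>
      simp only [Walk.cons_append, Walk.cons.injEq] at h
      obtain ⟨rfl, h⟩ := h
      have := ih (p' := r') (by simpa using hl) (eq_of_heq h)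
      exact ⟨by rw [this.1], this.2⟩

/-- Stepping repeatedly to a neighbour that lowers `d` by one reaches the target. This also yields
connectedness. -/
theorem exists_walk_of_recurrence {d : V → V → ℕ} (h0 : ∀ v, d v v = 0)
    (h2 : ∀ u v, u ≠ v → ∃ w, G.Adj u w ∧ d u v = d w v + 1) (u v : V) :
    ∃ p : G.Walk u v, p.length = d u v := by
  induction hn : d u v generalizing u with
  | zero =>
    by_cases huv : u = v
    · subst huv
      exact ⟨.nil, rfl⟩
    · obtain ⟨w, -, hw⟩ := h2 u v huv
      omega
  | succ n ih =>
    have huv : u ≠ v := by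
      rintro rfl
      have := h0 u
      omega
    obtain ⟨w, hadj, hw⟩ := h2 u v huv
    obtain ⟨p, hp⟩ := ih w (by omega)
    exact ⟨.cons hadj p, by simp [hp]⟩

theorem le_length_of_recurrence {d : V → V → ℕ} (h0 : ∀ v, d v v = 0)
    (h1 : ∀ u w v, G.Adj u w → d u v ≤ d w v + 1) {u v : V} (p : G.Walk u v) :
    d u v ≤ p.length := by
  induction p with
  | nil => simp [h0]
  | cons hadj q ih =>
    have := h1 _ _ _ hadj |>.trans (Nat.succ_le_succ ih)
    simpa using this

/-- A function on pairs that satisfies the recurrence of the distance is the distance. -/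
theorem dist_eq_of_recurrence {d : V → V → ℕ} (h0 : ∀ v, d v v = 0)
    (h1 : ∀ u w v, G.Adj u w → d u v ≤ d w v + 1)
    (h2 : ∀ u v, u ≠ v → ∃ w, G.Adj u w ∧ d u v = d w v + 1) (u v : V) :
    G.dist u v = d u v := by
  obtain ⟨p, hp⟩ := exists_walk_of_recurrence h0 h2 u v
  obtain ⟨q, hq⟩ := p.reachable.exists_walk_length_eq_dist
  exact le_antisymm (hp ▸ dist_le p) (hq ▸ le_length_of_recurrence h0 h1 q)

end SimpleGraph

/-! ### Counting shortest paths -/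

namespace Centrality

open SimpleGraph

theorem numShortest_self {V : Type*} (G : SimpleGraph V) (v : V) : numShortest G v v = 1 := by
  rw [numShortest, Set.ncard_eq_one]
  refine ⟨.nil, Set.ext fun p => ?_⟩
  simp [Walk.length_eq_zero_iff]

open Classical in
theorem numShortest_eq_adjMatrix_pow {V : Type*} [Fintype V] (G : SimpleGraph V) (u v : V) :
    numShortest G u v = (G.adjMatrix ℕ ^ G.dist u v) u v := by
  rw [adjMatrix_pow_apply_eq_card_walk, numShortest, Nat.cast_id, ← Nat.card_coe_set_eq,
    Nat.card_eq_fintype_card]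

open Classical in
theorem numShortest_recurrence {V : Type*} [Fintype V] {G : SimpleGraph V} (hG : G.Connected)
    {u v : V} (huv : u ≠ v) :
    numShortest G u v =
      ∑ w, if G.Adj u w ∧ G.dist w v + 1 = G.dist u v then numShortest G w v else 0 := by
  obtain ⟨n, hn⟩ : ∃ n, G.dist u v = n + 1 :=
    Nat.exists_eq_succ_of_ne_zero (hG.pos_dist_of_ne huv).ne'
  rw [numShortest_eq_adjMatrix_pow, hn, pow_succ', Matrix.mul_apply]
  refine Finset.sum_congr rfl fun w _ => ?_
  by_cases hadj : G.Adj u w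
  · by_cases hw : G.dist w v = n
    · simp [hadj, hw, numShortest_eq_adjMatrix_pow]
    -- The triangle inequality excludes smaller distances, so no walk of length `n` joins `w` to
    -- `v`.
    · have hlt : n < G.dist w v := by
        have h1 := hG.dist_triangle (u := u) (v := w) (w := v)
        rw [dist_eq_one_iff_adj.2 hadj] at h1
        omega
      simp only [adjMatrix_apply, hadj, if_true, one_mul, Nat.add_right_cancel_iff, hw, and_false,
        if_false]
      rw [adjMatrix_pow_apply_eq_card_walk, Nat.cast_id, Fintype.card_eq_zero_iff]
      exact ⟨fun p => absurd (dist_le p.1) (by rw [p.2]; omega)⟩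
  · simp [hadj]

/-- A function on pairs that satisfies the recurrence of the number of shortest paths is that
number. -/
theorem numShortest_eq_of_recurrence {V : Type*} [Fintype V] {G : SimpleGraph V}
    (hG : G.Connected) {s : V → V → ℕ} (h0 : ∀ v, s v v = 1)
    (h1 : ∀ u v, u ≠ v → s u v =
      ∑ w, open Classical in if G.Adj u w ∧ G.dist w v + 1 = G.dist u v then s w v else 0)
    (u v : V) : numShortest G u v = s u v := by
  induction hn : G.dist u v using Nat.strong_induction_on generalizing u with
  | _ n ih =>
    by_cases huv : u = v
    · rw [huv, numShortest_self, h0]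
    · rw [numShortest_recurrence hG huv, h1 u v huv]
      refine Finset.sum_congr rfl fun w _ => ?_
      split_ifs with h
      · exact ih _ (by omega) w rfl
      · rfl

theorem numShortestThrough_eq_zero {V : Type*} {G : SimpleGraph V} {y z x : V}
    (h : G.dist y x + G.dist x z ≠ G.dist y z) (hG : G.Connected) :
    numShortestThrough G y z x = 0 := by
  classical
  rw [numShortestThrough]
  convert Set.ncard_empty (G.Walk y z)
  refine Set.eq_empty_iff_forall_notMem.2 fun p ⟨hp, hx⟩ => ?_
  have h1 := dist_le (p.takeUntil x hx)
  have h2 := dist_le (p.dropUntil x hx)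
  have h3 := congrArg Walk.length (p.take_spec hx)
  rw [Walk.length_append, hp] at h3
  have h4 := hG.dist_triangle (u := y) (v := x) (w := z)
  omega

/-- Concatenation is a bijection from pairs of shortest paths onto the shortest paths through `x`.
It is injective because the length of the first part is fixed. -/
theorem numShortestThrough_eq_mul {V : Type*} {G : SimpleGraph V} {y z x : V}
    (h : G.dist y x + G.dist x z = G.dist y z) :
    numShortestThrough G y z x = numShortest G y x * numShortest G x z := by
  classical
  rw [numShortestThrough, numShortest, numShortest, ← Set.ncard_prod]
  symm
  refine Set.ncard_congr (fun p _ => p.1.append p.2) ?_ ?_ ?_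
  · rintro ⟨p, q⟩ ⟨hp, hq⟩
    simp only [Set.mem_ofPred_eq] at hp hq ⊢
    exact ⟨by rw [Walk.length_append, hp, hq, h], by simp⟩
  · rintro ⟨p, q⟩ ⟨p', q'⟩ ⟨hp, hq⟩ ⟨hp', hq'⟩ he
    simp only [Set.mem_ofPred_eq] at hp hq hp' hq'
    obtain ⟨rfl, rfl⟩ := Walk.append_inj_of_length_eq (hp.trans hp'.symm) he
    rfl
  · rintro p ⟨hp, hx⟩
    refine ⟨(p.takeUntil x hx, p.dropUntil x hx), ?_, p.take_spec hx⟩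
    have h1 := dist_le (p.takeUntil x hx)
    have h2 := dist_le (p.dropUntil x hx)
    have h3 := congrArg Walk.length (p.take_spec hx)
    rw [Walk.length_append, hp] at h3
    constructor <;> simp only [Set.mem_ofPred_eq] <;> omega


/-! ### Vertex types and path tables -/

/-- The type of a special vertex. -/
abbrev specialType (i : Fin 7) : Fin 10 := i.castLE (by decide)

/-- The type of a vertex of the parametric graph: a special vertex is its own type, and the types
`7`, `8`, `9` are those of the leaves attached to `0`, of the leaves attached to `1`, and of the
vertices labeled with `4`. -/
def vtxType {k h j : ℕ} : Vtx k h j → Fin 10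
  | Sum.inl i => specialType i
  | Sum.inr (Sum.inl _) => 7
  | Sum.inr (Sum.inr (Sum.inl _)) => 8
  | Sum.inr (Sum.inr (Sum.inr _)) => 9

/-- The distance in `pre k h j` between two distinct vertices of given types. -/
def preDist : Fin 10 → Fin 10 → ℕ := ![
    ![0, 2, 3, 1, 2, 3, 4, 1, 3, 4],
    ![2, 0, 1, 1, 2, 3, 2, 3, 1, 3],
    ![3, 1, 0, 2, 3, 2, 1, 4, 2, 2],
    ![1, 1, 2, 0, 1, 2, 3, 2, 2, 3],
    ![2, 2, 3, 1, 0, 1, 2, 3, 3, 2],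
    ![3, 3, 2, 2, 1, 0, 1, 4, 4, 1],
    ![4, 2, 1, 3, 2, 1, 0, 5, 3, 1],
    ![1, 3, 4, 2, 3, 4, 5, 2, 4, 5],
    ![3, 1, 2, 2, 3, 4, 3, 4, 2, 4],
    ![4, 3, 2, 3, 2, 1, 1, 5, 4, 2]]

/-- The number of shortest paths in `pre k h j` between two distinct vertices of given types. -/
def preCount : Fin 10 → Fin 10 → ℕ := ![
    ![1, 1, 1, 1, 1, 1, 2, 1, 1, 1],
    ![1, 1, 1, 1, 1, 2, 1, 1, 1, 1],
    ![1, 1, 1, 1, 2, 1, 1, 1, 1, 1],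
    ![1, 1, 1, 1, 1, 1, 2, 1, 1, 1],
    ![1, 1, 2, 1, 1, 1, 1, 1, 1, 1],
    ![1, 2, 1, 1, 1, 1, 1, 1, 2, 1],
    ![2, 1, 1, 2, 1, 1, 1, 2, 1, 1],
    ![1, 1, 1, 1, 1, 1, 2, 1, 1, 1],
    ![1, 1, 1, 1, 1, 2, 1, 1, 1, 1],
    ![1, 1, 1, 1, 1, 1, 1, 1, 1, 2]]

/-- The distance in `post k h j` between two distinct vertices of given types. -/
def postDist : Fin 10 → Fin 10 → ℕ := ![
    ![0, 1, 2, 1, 2, 3, 3, 1, 2, 4],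
    ![1, 0, 1, 1, 2, 3, 2, 2, 1, 3],
    ![2, 1, 0, 2, 3, 2, 1, 3, 2, 2],
    ![1, 1, 2, 0, 1, 2, 3, 2, 2, 3],
    ![2, 2, 3, 1, 0, 1, 2, 3, 3, 2],
    ![3, 3, 2, 2, 1, 0, 1, 4, 4, 1],
    ![3, 2, 1, 3, 2, 1, 0, 4, 3, 1],
    ![1, 2, 3, 2, 3, 4, 4, 2, 3, 5],
    ![2, 1, 2, 2, 3, 4, 3, 3, 2, 4],
    ![4, 3, 2, 3, 2, 1, 1, 5, 4, 2]]

/-- The number of shortest paths in `post k h j` between two distinct vertices of given types. -/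
def postCount : Fin 10 → Fin 10 → ℕ := ![
    ![1, 1, 1, 1, 1, 1, 1, 1, 1, 2],
    ![1, 1, 1, 1, 1, 2, 1, 1, 1, 1],
    ![1, 1, 1, 1, 2, 1, 1, 1, 1, 1],
    ![1, 1, 1, 1, 1, 1, 2, 1, 1, 1],
    ![1, 1, 2, 1, 1, 1, 1, 1, 1, 1],
    ![1, 2, 1, 1, 1, 1, 1, 1, 2, 1],
    ![1, 1, 1, 2, 1, 1, 1, 1, 1, 1],
    ![1, 1, 1, 1, 1, 1, 1, 1, 1, 2],
    ![1, 1, 1, 1, 1, 2, 1, 1, 1, 1],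
    ![2, 1, 1, 1, 1, 1, 1, 2, 1, 2]]


/-- Local consistency of a table of distances and of a table of numbers of shortest paths between
vertices of given types. -/
structure IsPathTable (D S : Fin 10 → Fin 10 → ℕ) : Prop where
  dist_special : ∀ i : Fin 7, D (specialType i) (specialType i) = 0
  count_special : ∀ i : Fin 7, S (specialType i) (specialType i) = 1
  dist_le : ∀ a b c, D a b = 1 → D a c ≤ D b c + 1
  -- The guard `a = c → 7 ≤ a` holds for the types of any two distinct vertices: diagonal entries
  -- from `7` on refer to distinct twins.
  exists_next : ∀ a c, (a = c → 7 ≤ a) → D a c ≠ 1 →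
    ∃ i : Fin 7, D a (specialType i) = 1 ∧ D a c = D (specialType i) c + 1
  count_adj : ∀ a c, D a c = 1 → S a c = 1
  not_through : ∀ a b c, 7 ≤ b → (a = c → 7 ≤ a) → D a b = 1 → D b c + 1 ≠ D a c
  count_rec : ∀ a c, (a = c → 7 ≤ a) → D a c ≠ 1 → S a c =
    ∑ i : Fin 7, if D a (specialType i) = 1 ∧ D (specialType i) c + 1 = D a c
      then S (specialType i) c else 0
  eq_special : ∀ a c, D a c = 0 → a = c ∧ a < 7
  count_dvd_two : ∀ a c, S a c ∣ 2

theorem isPathTable_pre : IsPathTable preDist preCount where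
  dist_special := by decide
  count_special := by decide
  dist_le := by decide
  exists_next := by decide
  count_adj := by decide
  not_through := by decide
  count_rec := by decide
  eq_special := by decide
  count_dvd_two := by decide

theorem isPathTable_post : IsPathTable postDist postCount where
  dist_special := by decide
  count_special := by decide
  dist_le := by decide
  exists_next := by decide
  count_adj := by decide
  not_through := by decide
  count_rec := by decide
  eq_special := by decide
  count_dvd_two := by decide

theorem pre_adj_iff {k h j : ℕ} (u v : Vtx k h j) :
    (pre k h j).Adj u v ↔ preDist (vtxType u) (vtxType v) = 1 := by
  rcases u with u | u | u | u <;> rcases v with v | v | v | v <;>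
    simp only [pre, SimpleGraph.fromRel_adj, arc, vtxType, ne_eq, Sum.inl.injEq, Sum.inr.injEq,
      reduceCtorEq, not_false_eq_true, true_and, or_false, false_or, or_self, and_false,
      false_iff] <;>
    first | decide | (revert u v; decide) | (revert u; decide) | (revert v; decide)

theorem post_adj_iff {k h j : ℕ} (u v : Vtx k h j) :
    (post k h j).Adj u v ↔ postDist (vtxType u) (vtxType v) = 1 := by
  rw [post, addEdge, SimpleGraph.sup_adj, pre_adj_iff, SimpleGraph.edge_adj]
  rcases u with u | u | u | u <;> rcases v with v | v | v | v <;>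
    simp only [vtxType, special, ne_eq, Sum.inl.injEq, Sum.inr.injEq,
      reduceCtorEq, not_false_eq_true, or_false, or_self, and_false,
      false_and] <;>
    first | decide | (revert u v; decide) | (revert u; decide) | (revert v; decide)

variable {k h j : ℕ}

theorem seven_le_vtxType_of_eq {u v : Vtx k h j} (huv : u ≠ v) (ht : vtxType u = vtxType v) :
    7 ≤ vtxType u := by
  rcases u with u | u | u | u <;> rcases v with v | v | v | v <;>
    simp only [vtxType] at ht ⊢ <;>
    first | decide | skip
  · exact absurd (congrArg Sum.inl (Fin.castLE_injective _ ht)) huv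
  all_goals exact ht.ge.trans' (by decide)

variable {G : SimpleGraph (Vtx k h j)} {D S : Fin 10 → Fin 10 → ℕ}

section
open Classical

/-- The distance table as a function of the vertices. -/
def tableDist (D : Fin 10 → Fin 10 → ℕ) (u v : Vtx k h j) : ℕ :=
  if u = v then 0 else D (vtxType u) (vtxType v)

/-- The table of the numbers of shortest paths as a function of the vertices. -/
def tableCount (S : Fin 10 → Fin 10 → ℕ) (u v : Vtx k h j) : ℕ :=
  if u = v then 1 else S (vtxType u) (vtxType v)

namespace IsPathTable

theorem tableDist_special (hT : IsPathTable D S) (i : Fin 7) (v : Vtx k h j) :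
    tableDist D (Sum.inl i) v = D (specialType i) (vtxType v) := by
  rw [tableDist]
  split_ifs with hi
  · rw [← hi]
    exact (hT.dist_special i).symm
  · rfl

theorem tableCount_special (hT : IsPathTable D S) (i : Fin 7) (v : Vtx k h j) :
    tableCount S (Sum.inl i) v = S (specialType i) (vtxType v) := by
  rw [tableCount]
  split_ifs with hi
  · rw [← hi]
    exact (hT.count_special i).symm
  · rfl

theorem exists_adj (hT : IsPathTable D S)
    (hG : ∀ u v, G.Adj u v ↔ D (vtxType u) (vtxType v) = 1) (u v : Vtx k h j) (huv : u ≠ v) :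
    ∃ w, G.Adj u w ∧ tableDist D u v = tableDist D w v + 1 := by
  by_cases hadj : D (vtxType u) (vtxType v) = 1
  · exact ⟨v, (hG u v).2 hadj, by simp [tableDist, huv, hadj]⟩
  · obtain ⟨i, h1, h2⟩ := hT.exists_next _ _ (seven_le_vtxType_of_eq huv) hadj
    exact ⟨Sum.inl i, (hG _ _).2 h1, by
      rw [hT.tableDist_special, ← h2, tableDist, if_neg huv]⟩

theorem dist_eq (hT : IsPathTable D S)
    (hG : ∀ u v, G.Adj u v ↔ D (vtxType u) (vtxType v) = 1) (u v : Vtx k h j) :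
    G.dist u v = tableDist D u v := by
  refine dist_eq_of_recurrence (by simp [tableDist]) ?_ (hT.exists_adj hG) u v
  intro u w v hadj
  rw [hG] at hadj
  by_cases huv : u = v
  · simp [tableDist, huv]
  by_cases hwv : w = v
  · subst hwv
    simp [tableDist, huv, hadj]
  · simpa [tableDist, huv, hwv] using hT.dist_le _ _ _ hadj

theorem connected (hT : IsPathTable D S)
    (hG : ∀ u v, G.Adj u v ↔ D (vtxType u) (vtxType v) = 1) : G.Connected :=
  have : Nonempty (Vtx k h j) := ⟨special 0⟩
  ⟨fun u v =>
    (exists_walk_of_recurrence (by simp [tableDist]) (hT.exists_adj hG) u v).choose.reachable⟩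

theorem numShortest_eq (hT : IsPathTable D S)
    (hG : ∀ u v, G.Adj u v ↔ D (vtxType u) (vtxType v) = 1) (u v : Vtx k h j) :
    numShortest G u v = tableCount S u v := by
  refine numShortest_eq_of_recurrence (hT.connected hG) (by simp [tableCount]) ?_ u v
  intro u v huv
  simp only [hT.dist_eq hG, hG]
  by_cases hadj : D (vtxType u) (vtxType v) = 1
  · rw [Finset.sum_eq_single v]
    · simp [tableDist, tableCount, huv, hadj, hT.count_adj _ _ hadj]
    · intro w _ hwv
      rw [if_neg]
      rintro ⟨-, hw⟩
      simp only [tableDist, hwv, huv, if_false, hadj, Nat.add_eq_right] at hw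
      obtain ⟨h1, h2⟩ := hT.eq_special _ _ hw
      exact absurd (seven_le_vtxType_of_eq hwv h1) (not_le.2 h2)
    · simp
  -- A shortest path of length at least two starts with a step to a special vertex, so the sum
  -- reduces to seven terms.
  · have hr : ∀ w : Fin k ⊕ (Fin h ⊕ Fin j), 7 ≤ vtxType (Sum.inr w : Vtx k h j) := by
      rintro (w | w | w) <;> simp only [vtxType] <;> decide
    rw [Fintype.sum_sum_type,
      Finset.sum_eq_zero (s := (Finset.univ : Finset (Fin k ⊕ _))), add_zero]
    · simp only [hT.tableDist_special, hT.tableCount_special]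
      simp only [tableDist, tableCount, if_neg huv]
      exact hT.count_rec _ _ (seven_le_vtxType_of_eq huv) hadj
    · intro w _
      rw [if_neg]
      rintro ⟨h1, hw⟩
      by_cases hwv : Sum.inr w = v
      · exact hadj (hwv ▸ h1)
      · simp only [tableDist, hwv, huv, if_false] at hw
        exact hT.not_through _ _ _ (hr w) (seven_le_vtxType_of_eq huv) h1 hw

end IsPathTable

end

/-! ### Betweenness as a polynomial -/

/-- Twice the fraction of the shortest paths between two distinct vertices of types `a` and `c`
that pass through the special vertex `i`, a pair that contains `i` counting as `0`. -/
def pairDependency (D S : Fin 10 → Fin 10 → ℕ) (i : Fin 7) (a c : Fin 10) : ℕ :=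
  if a ≠ specialType i ∧ c ≠ specialType i ∧
      D a (specialType i) + D (specialType i) c = D a c then
    S a (specialType i) * S (specialType i) c * (2 / S a c)
  else 0

theorem vtxType_eq_specialType_iff {u : Vtx k h j} {i : Fin 7} :
    vtxType u = specialType i ↔ u = Sum.inl i := by
  refine ⟨fun hu => ?_, fun hu => by rw [hu, vtxType]⟩
  by_contra hne
  have h7 := seven_le_vtxType_of_eq hne (by rw [hu, vtxType])
  rw [hu, Fin.le_def] at h7
  exact absurd h7 (not_le.2 i.isLt)

/-- The number of vertices of each type. -/
def typeCard (k h j : ℕ) : Fin 10 → ℝ := ![1, 1, 1, 1, 1, 1, 1, k, h, j]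

theorem sum_vtxType (f : Fin 10 → ℝ) :
    ∑ u : Vtx k h j, f (vtxType u) = ∑ a, typeCard k h j a * f a := by
  simp only [Fintype.sum_sum_type, vtxType, Finset.sum_const, Finset.card_univ, Fintype.card_fin,
    nsmul_eq_mul, Fin.sum_univ_succ, Fin.sum_univ_zero, typeCard, Matrix.cons_val_zero,
    Matrix.cons_val_succ, one_mul, add_zero, ← add_assoc]
  rfl

theorem IsPathTable.numShortestThrough_div (hT : IsPathTable D S)
    (hG : ∀ u v, G.Adj u v ↔ D (vtxType u) (vtxType v) = 1) (i : Fin 7) {u v : Vtx k h j}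
    (hu : u ≠ special i) (hv : v ≠ special i) (huv : u ≠ v) :
    (numShortestThrough G u v (special i) : ℝ) / numShortest G u v =
      pairDependency D S i (vtxType u) (vtxType v) / 2 := by
  have hS : numShortest G u v = S (vtxType u) (vtxType v) := by
    rw [hT.numShortest_eq hG, tableCount, if_neg huv]
  have hSu : numShortest G u (special i) = S (vtxType u) (specialType i) := by
    rw [hT.numShortest_eq hG, tableCount, if_neg hu]
    rfl
  have hSv : numShortest G (special i) v = S (specialType i) (vtxType v) := by
    rw [hT.numShortest_eq hG, hT.tableCount_special]
  have hd : G.dist u (special i) + G.dist (special i) v = G.dist u v ↔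
      D (vtxType u) (specialType i) + D (specialType i) (vtxType v) =
        D (vtxType u) (vtxType v) := by
    rw [hT.dist_eq hG, hT.dist_eq hG, hT.dist_eq hG, hT.tableDist_special, tableDist, tableDist,
      if_neg hu, if_neg huv]
    rfl
  by_cases h1 : G.dist u (special i) + G.dist (special i) v = G.dist u v
  · rw [numShortestThrough_eq_mul h1, hS, hSu, hSv, pairDependency, if_pos
      ⟨mt vtxType_eq_specialType_iff.1 hu, mt vtxType_eq_specialType_iff.1 hv, hd.1 h1⟩]
    have h2 := hT.count_dvd_two (vtxType u) (vtxType v)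
    have h3 : (S (vtxType u) (vtxType v) : ℝ) ≠ 0 := by
      rw [Nat.cast_ne_zero]
      rintro h0
      simp [h0] at h2
    push_cast [Nat.cast_div h2 h3]
    field_simp
  · rw [numShortestThrough_eq_zero h1 (hT.connected hG), pairDependency,
      if_neg fun h => h1 (hd.2 h.2.2)]
    simp

/-- The divisor `4` undoes the ordering of pairs and the doubling in `pairDependency`. The
subtracted term removes `v = u`, where the table would describe two distinct twins. -/
theorem IsPathTable.betweenness_eq_sum (hT : IsPathTable D S)
    (hG : ∀ u v, G.Adj u v ↔ D (vtxType u) (vtxType v) = 1) (i : Fin 7) :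
    betweenness G (special i) =
      (∑ u : Vtx k h j, (∑ v : Vtx k h j, (pairDependency D S i (vtxType u) (vtxType v) : ℝ) -
        pairDependency D S i (vtxType u) (vtxType u))) / 4 := by
  classical
  have h4 : (4 : ℝ) = 2 * 2 := by norm_num
  rw [betweenness, h4, ← div_div]
  congr 1
  rw [Finset.sum_div]
  refine Finset.sum_congr rfl fun u _ => ?_
  rw [← Finset.sum_erase_eq_sub (Finset.mem_univ u), Finset.sum_div, ← Finset.sum_erase]
  · refine Finset.sum_congr rfl fun v hv => ?_
    have huv := (Finset.ne_of_mem_erase hv).symm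
    by_cases hu : u = special i
    · rw [if_neg fun h => h.1 hu, pairDependency,
        if_neg fun h => h.1 (vtxType_eq_specialType_iff.2 hu)]
      simp
    by_cases hv : v = special i
    · rw [if_neg fun h => h.2.1 hv, pairDependency,
        if_neg fun h => h.2.1 (vtxType_eq_specialType_iff.2 hv)]
      simp
    rw [if_pos ⟨hu, hv, huv⟩, hT.numShortestThrough_div hG i hu hv huv]
  · simp

theorem IsPathTable.betweenness_eq (hT : IsPathTable D S)
    (hG : ∀ u v, G.Adj u v ↔ D (vtxType u) (vtxType v) = 1) (i : Fin 7) :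
    betweenness G (special i) =
      (∑ a, typeCard k h j a * (∑ c, typeCard k h j c * (pairDependency D S i a c : ℝ) -
        pairDependency D S i a a)) / 4 := by
  rw [hT.betweenness_eq_sum hG]
  congr 1
  rw [← sum_vtxType fun a => ∑ c, typeCard k h j c * (pairDependency D S i a c : ℝ) -
        pairDependency D S i a a]
  refine Finset.sum_congr rfl fun u _ => ?_
  rw [sum_vtxType fun c => (pairDependency D S i (vtxType u) c : ℝ)]


variable (k h j : ℕ)

/-- This is `k(k-1)/2 + k(h+j+6)`: every pair containing a leaf of `0` and not `0` itself counts
fully, and no other pair counts. -/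
theorem betweenness_pre_zero : betweenness (pre k h j) (special 0) =
    ((k : ℝ) ^ 2 + 2 * k * h + 2 * k * j + 11 * k) / 2 := by
  rw [isPathTable_pre.betweenness_eq pre_adj_iff]
  simp [Fin.sum_univ_succ, typeCard, pairDependency, preDist, preCount]
  ring

theorem betweenness_pre_one : betweenness (pre k h j) (special 1) =
    ((h : ℝ) ^ 2 + 2 * h * k + 2 * h * j + 11 * h + 3 * k + 7) / 2 := by
  rw [isPathTable_pre.betweenness_eq pre_adj_iff]
  simp [Fin.sum_univ_succ, typeCard, pairDependency, preDist, preCount,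
    show specialType 1 = 1 from rfl]
  ring

theorem betweenness_pre_two : betweenness (pre k h j) (special 2) =
    (2 * (h : ℝ) * j + 2 * j + 3 * h + k + 5) / 2 := by
  rw [isPathTable_pre.betweenness_eq pre_adj_iff]
  simp [Fin.sum_univ_succ, typeCard, pairDependency, preDist, preCount,
    show specialType 2 = 2 from rfl]
  ring

theorem betweenness_post_zero : betweenness (post k h j) (special 0) =
    ((k : ℝ) ^ 2 + 2 * k * h + 2 * k * j + 11 * k) / 2 := by
  rw [isPathTable_post.betweenness_eq post_adj_iff]
  simp [Fin.sum_univ_succ, typeCard, pairDependency, postDist, postCount]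
  ring

theorem betweenness_post_two : betweenness (post k h j) (special 2) =
    (2 * (h : ℝ) * j + k * j + 3 * j + 3 * h + 2 * k + 6) / 2 := by
  rw [isPathTable_post.betweenness_eq post_adj_iff]
  simp [Fin.sum_univ_succ, typeCard, pairDependency, postDist, postCount,
    show specialType 2 = 2 from rfl]
  ring

/-! ### Violations of monotonicity -/

theorem connected_pre : (pre k h j).Connected :=
  isPathTable_pre.connected pre_adj_iff

theorem not_adj_pre : ¬ (pre k h j).Adj (special 0) (special 1) := by
  rw [pre_adj_iff]
  exact (by decide : ¬ preDist 0 1 = 1)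

theorem special_zero_ne_one : (special 0 : Vtx k h j) ≠ special 1 :=
  Sum.inl_injective.ne (by decide)

theorem betweenness_post_zero_eq_pre :
    betweenness (post k h j) (special 0) = betweenness (pre k h j) (special 0) := by
  rw [betweenness_post_zero, betweenness_pre_zero]

theorem not_scoreMonotoneOn_pre : ¬ ScoreMonotoneOn betweenness (pre k h j) := fun hs =>
  (hs _ _ (special_zero_ne_one k h j) (not_adj_pre k h j)).1.ne
    (betweenness_post_zero_eq_pre k h j).symm

theorem RankViolationAt.not_rankMonotoneOn {V : Type*} {c : SimpleGraph V → V → ℝ}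
    {G : SimpleGraph V} {x y : V} (hv : RankViolationAt c G x y) : ¬ RankMonotoneOn c G := by
  obtain ⟨hxy, hadj, z, hzx, hzy, hz⟩ := hv
  intro hr
  obtain ⟨⟨h1, -⟩, h2, -⟩ := hr x y hxy hadj z hzx hzy
  exact hz.elim (fun hz => hz.2 (h1 hz.1)) (fun hz => hz.2 (h2 hz.1))

variable {k h j}

theorem rankViolationAt_pre
    (h1 : betweenness (pre k h j) (special 2) < betweenness (pre k h j) (special 0))
    (h2 : betweenness (post k h j) (special 0) < betweenness (post k h j) (special 2)) :
    RankViolationAt betweenness (pre k h j) (special 0) (special 1) :=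
  ⟨special_zero_ne_one k h j, not_adj_pre k h j, special 2, Sum.inl_injective.ne (by decide),
    Sum.inl_injective.ne (by decide), Or.inl ⟨h1, h2.le.not_gt⟩⟩

theorem top_pre_one_lt (hk : k = h + 2) :
    betweenness (pre k h j) (special 1) < betweenness (pre k h j) (special 0) := by
  rw [betweenness_pre_zero, betweenness_pre_one, hk]
  push_cast
  nlinarith [(Nat.cast_nonneg h : (0 : ℝ) ≤ h), (Nat.cast_nonneg j : (0 : ℝ) ≤ j)]

theorem top_pre_two_lt (hk : k = h + 2) (hj : j = 4 * h) :
    betweenness (pre k h j) (special 2) < betweenness (pre k h j) (special 0) := by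
  rw [betweenness_pre_zero, betweenness_pre_two, hj, hk]
  push_cast
  nlinarith [(Nat.cast_nonneg h : (0 : ℝ) ≤ h)]

theorem top_post_zero_lt (hk : k = h + 2) (hj : j = 4 * h) (hh : 12 ≤ h) :
    betweenness (post k h j) (special 0) < betweenness (post k h j) (special 2) := by
  rw [betweenness_post_zero, betweenness_post_two, hj, hk]
  push_cast
  -- Twice the difference is `h² - 10h - 16`, which is positive from `h = 12` on.
  nlinarith [(Nat.ofNat_le_cast.2 hh : (12 : ℝ) ≤ h)]

theorem bottom_pre_lt_one (hh : h = k) :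
    betweenness (pre k h j) (special 0) < betweenness (pre k h j) (special 1) := by
  rw [betweenness_pre_zero, betweenness_pre_one, hh]
  nlinarith [(Nat.cast_nonneg k : (0 : ℝ) ≤ k)]

theorem bottom_pre_two_lt (hh : h = k)
    (hj : (j : ℤ) = ⌊((k : ℝ) ^ 2 - 4 * (k : ℝ) - 15) / 2⌋) :
    betweenness (pre k h j) (special 2) < betweenness (pre k h j) (special 0) := by
  have hle := Int.floor_le (((k : ℝ) ^ 2 - 4 * (k : ℝ) - 15) / 2)
  rw [← hj, Int.cast_natCast] at hle
  rw [betweenness_pre_zero, betweenness_pre_two, hh]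
  nlinarith [(Nat.cast_nonneg k : (0 : ℝ) ≤ k)]

theorem bottom_post_zero_lt (hh : h = k)
    (hj : (j : ℤ) = ⌊((k : ℝ) ^ 2 - 4 * (k : ℝ) - 15) / 2⌋) (hk : 13 ≤ k) :
    betweenness (post k h j) (special 0) < betweenness (post k h j) (special 2) := by
  have hlt := Int.lt_floor_add_one (((k : ℝ) ^ 2 - 4 * (k : ℝ) - 15) / 2)
  rw [← hj, Int.cast_natCast] at hlt
  have hk' : (13 : ℝ) ≤ k := Nat.ofNat_le_cast.2 hk
  rw [betweenness_post_zero, betweenness_post_two, hh]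
  -- Rounding down loses less than `1`, so `2j > k² - 4k - 17`. Twice the difference of the scores
  -- is `(k+3)j - 3k² - 6k + 6`; doubled again, it exceeds `k³ - 7k² - 41k - 39`, which is the
  -- product in `h2` plus `37k - 39`.
  have h1 : ((k : ℝ) + 3) * ((k : ℝ) ^ 2 - 4 * k - 17) ≤ (k + 3) * (2 * j) :=
    mul_le_mul_of_nonneg_left (by linarith) (by linarith)
  have h2 : 0 ≤ ((k : ℝ) - 13) * (k * (k + 6)) := mul_nonneg (by linarith) (by positivity)
  nlinarith

end Centrality

theorem mainTheorem3 :
    -- score monotonicity, for all values of the parameters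
    (∀ k h j : ℕ,
      (Centrality.pre k h j).Connected ∧
      ¬ (Centrality.pre k h j).Adj (Centrality.special 0) (Centrality.special 1) ∧
      Centrality.betweenness (Centrality.post k h j) (Centrality.special 0) =
        Centrality.betweenness (Centrality.pre k h j) (Centrality.special 0) ∧
      ¬ Centrality.ScoreMonotoneOn Centrality.betweenness (Centrality.pre k h j)) ∧
    -- rank monotonicity, top violation
    (∀ k h j : ℕ, k = h + 2 → j = 4 * h → 12 ≤ h →
      Centrality.betweenness (Centrality.pre k h j) (Centrality.special 1) <
        Centrality.betweenness (Centrality.pre k h j) (Centrality.special 0) ∧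
      Centrality.betweenness (Centrality.pre k h j) (Centrality.special 2) <
        Centrality.betweenness (Centrality.pre k h j) (Centrality.special 0) ∧
      Centrality.betweenness (Centrality.post k h j) (Centrality.special 0) <
        Centrality.betweenness (Centrality.post k h j) (Centrality.special 2) ∧
      Centrality.TopRankViolation Centrality.betweenness (Centrality.pre k h j)
        (Centrality.special 0) (Centrality.special 1) ∧
      ¬ Centrality.RankMonotoneOn Centrality.betweenness (Centrality.pre k h j)) ∧
    -- rank monotonicity, bottom violation
    (∀ k h j : ℕ, h = k → (j : ℤ) = ⌊((k : ℝ) ^ 2 - 4 * (k : ℝ) - 15) / 2⌋ → 13 ≤ k →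
      Centrality.betweenness (Centrality.pre k h j) (Centrality.special 0) <
        Centrality.betweenness (Centrality.pre k h j) (Centrality.special 1) ∧
      Centrality.betweenness (Centrality.pre k h j) (Centrality.special 2) <
        Centrality.betweenness (Centrality.pre k h j) (Centrality.special 0) ∧
      Centrality.betweenness (Centrality.post k h j) (Centrality.special 0) <
        Centrality.betweenness (Centrality.post k h j) (Centrality.special 2) ∧
      Centrality.BottomRankViolation Centrality.betweenness (Centrality.pre k h j)
        (Centrality.special 0) (Centrality.special 1) ∧
      ¬ Centrality.RankMonotoneOn Centrality.betweenness (Centrality.pre k h j)) ∧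
    -- hence neither axiom holds on undirected graphs
    ¬ Centrality.ScoreMonotone (fun _ _ => Centrality.betweenness) ∧
    ¬ Centrality.RankMonotone (fun _ _ => Centrality.betweenness) := by
  have top (k h j : ℕ) (hk : k = h + 2) (hj : j = 4 * h) (hh : 12 ≤ h) :=
    Centrality.rankViolationAt_pre (Centrality.top_pre_two_lt hk hj)
      (Centrality.top_post_zero_lt hk hj hh)
  refine ⟨fun k h j => ⟨Centrality.connected_pre k h j, Centrality.not_adj_pre k h j,
    Centrality.betweenness_post_zero_eq_pre k h j, Centrality.not_scoreMonotoneOn_pre k h j⟩,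
    fun k h j hk hj hh => ?_, fun k h j hh hj hk => ?_,
    fun hs => Centrality.not_scoreMonotoneOn_pre 0 0 0 (hs _ _),
    fun hr => (top 14 12 48 rfl rfl le_rfl).not_rankMonotoneOn (hr _ _)⟩
  · have hv := top k h j hk hj hh
    exact ⟨Centrality.top_pre_one_lt hk, Centrality.top_pre_two_lt hk hj,
      Centrality.top_post_zero_lt hk hj hh, ⟨hv, Centrality.top_pre_one_lt hk⟩,
      hv.not_rankMonotoneOn⟩
  · have h1 := Centrality.bottom_pre_lt_one (j := j) hh
    have h2 := Centrality.bottom_pre_two_lt hh hj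
    have h3 := Centrality.bottom_post_zero_lt hh hj hk
    have hv := Centrality.rankViolationAt_pre h2 h3
    exact ⟨h1, h2, h3, ⟨hv, h1.le.not_gt⟩, hv.not_rankMonotoneOn⟩
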